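/- **Conventions.** Let $\hbar$ be a formal variable. A $\mathbb{C}[[\hbar]]$-module $W$ is topologically free if $W=W_0[[\hbar]]$ for some complex vector space $W_0$. For such $W$ put $\mathcal{E}_\hbar(W)=\mathrm{Hom}_{\mathbb{C}[[\hbar]]}(W,W_0((z))[[\hbar]])$; let $\pi_n$ denote reduction modulo $\hbar^n$ of $\mathrm{End}(W)$-valued series. For a $\mathbb{C}[[\hbar]]$-module $M$ put $\mathcal{E}^{(k)}(M)=\mathrm{Hom}_{\mathbb{C}[[\hbar]]}(M,M((z_1,\dots,z_k)))$. A subset of $\mathcal{E}_\hbar(W)$ is $\hbar$-adically compatible if for every finite sequence $a_1(z),\dots,a_k(z)$ in it and every $n\ge 1$ there is $m\ge 1$ with $$\Big(\prod_{1\le i<j\le k}(z_i-z_j)^m\Big)\,\pi_n(a_1(z_1))\cdots\pi_n(a_k(z_k))\in\mathcal{E}^{(k)}(W/\hbar^nW).$$ For an $\hbar$-adically compatible pair, $Y_{\mathcal{E}}(a(z),z_0)b(z)$ is the series whose reduction modulo $\hbar^n$, for each $n\ge 1$, is $$z_0^{-k_n}\Big((z_1-z)^{k_n}\pi_n(a(z_1))\pi_n(b(z))\Big)\Big|_{z_1=z+z_0},$$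 where $k_n\ge 0$ is any integer with $(z_1-z)^{k_n}\pi_n(a(z_1))\pi_n(b(z))\in\mathcal{E}^{(2)}(W/\hbar^nW)$, and powers of $z+z_0$ are expanded in nonnegative powers of $z_0$. An $\hbar$-adic nonlocal vertex algebra (VA) is a topologically free $\mathbb{C}[[\hbar]]$-module $V$ with a vector $\mathbf{1}$ and a $\mathbb{C}[[\hbar]]$-module map $Y(\cdot,z):V\to\mathcal{E}_\hbar(V)$, $Y(u,z)=\sum_{m\in\mathbb{Z}}u_mz^{-m-1}$, such that $Y(\mathbf{1},z)v=v$, $Y(v,z)\mathbf{1}\in V[[z]]$ and $\lim_{z\to0}Y(v,z)\mathbf{1}=v$ for $v\in V$, the set $\{Y(u,z)\mid u\in V\}$ is $\hbar$-adically compatible, and $Y_{\mathcal{E}}(Y(u,z),z_0)Y(v,z)=Y(Y(u,z_0)v,z)$ for $u,v\in V$. A $V$-module is a topologically free $\mathbb{C}[[\hbar]]$-module $W$ with a $\mathbb{C}[[\hbar]]$-module map $Y_W(\cdot,z):V\to\mathcal{E}_\hbar(W)$ such that $Y_W(\mathbf{1},z)=1_W$, the set $\{Y_W(u,z)\mid u\in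 V\}$ is $\hbar$-adically compatible, and $Y_{\mathcal{E}}(Y_W(u,z),z_0)Y_W(v,z)=Y_W(Y(u,z_0)v,z)$ for $u,v\in V$. A homomorphism $\psi:U\to V$ of $\hbar$-adic nonlocal VAs is a $\mathbb{C}[[\hbar]]$-module map with $\psi(\mathbf{1}_U)=\mathbf{1}_V$ and $\psi(Y_U(u,z)v)=Y_V(\psi(u),z)\psi(v)$ for $u,v\in U$. For a submodule $P$ of an $\hbar$-adic nonlocal VA $V$ let $\overline{P}$ be its $\hbar$-adic closure, $[P]=\{v\in V\mid\hbar^nv\in P\text{ for some }n\ge1\}$ and $P'=\mathrm{span}_{\mathbb{C}[[\hbar]]}\{u_mv\mid u,v\in P,\ m\in\mathbb{Z}\}$. For $S\subset V$ let $S^{(1)}=\overline{[\mathrm{span}_{\mathbb{C}[[\hbar]]}(S\cup\{\mathbf{1}\})]}$, $S^{(n+1)}=\overline{[(S^{(n)})']}$ for $n\ge1$, and $\langle S\rangle=\overline{[\bigcup_{n\ge1}S^{(n)}]}$. One says that $V$ is generated by $S$ if $\langle S\rangle=V$. **Proposition.** Let $(U,Y_U,\mathbf{1}_U)$ and $(V,Y_V,\mathbf{1}_V)$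 be $\hbar$-adic nonlocal VAs, and let $S$ be a $\mathbb{C}[[\hbar]]$-submodule of $U$ such that $U$ is generated by $S$. Assume that there is a $U$-module structure $Y_V^U$ on the $\mathbb{C}[[\hbar]]$-module $V$ such that $$Y_V^U(u,z)\mathbf{1}_V\in V[[z]]\quad\text{for all }u\in U.$$ Suppose that $\psi^0:S\to V$ is a $\mathbb{C}[[\hbar]]$-module map such that $$Y_V^U(s,z)=Y_V(\psi^0(s),z)\quad\text{for all }s\in S.$$ Then there exists a homomorphism $\psi:U\to V$ of $\hbar$-adic nonlocal VAs such that $\psi(s)=\psi^0(s)$ for all $s\in S$. -/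

import Mathlib

namespace HAdic

noncomputable section

/-- The ring `ℂ[[ħ]]` of formal power series in the formal variable `ħ`. -/
abbrev HRing : Type := PowerSeries ℂ

/-- The formal variable `ħ`. -/
def hbar : HRing := PowerSeries.X

/-- `W` is topologically free if `W = W₀[[ħ]]` for some complex vector space `W₀`: the elements of
`W` are identified with the sequences `∑ₙ wₙ ħⁿ` of elements of `W₀`, added termwise, with
`ℂ[[ħ]]` acting by the Cauchy product. (As `W₀ ≅ W / ħW`, it may be taken in the universe
of `W`.) -/
def TopologicallyFree.{u} (W : Type u) [AddCommGroup W] [Module HRing W] : Prop :=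
  ∃ (W₀ : Type u) (_ : AddCommGroup W₀) (_ : Module ℂ W₀) (e : W ≃+ (ℕ → W₀)),
    ∀ (f : HRing) (w : W) (n : ℕ),
      e (f • w) n = ∑ p ∈ Finset.HasAntidiagonal.antidiagonal n, PowerSeries.coeff p.1 f • e w p.2

/-- The submodule `ħⁿ W` of `W`. -/
def hPow (W : Type*) [AddCommGroup W] [Module HRing W] (n : ℕ) : Submodule HRing W :=
  LinearMap.range (LinearMap.lsmul HRing W (hbar ^ n))

theorem hPow_le_comap {W : Type*} [AddCommGroup W] [Module HRing W] (n : ℕ)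
    (f : Module.End HRing W) : hPow W n ≤ (hPow W n).comap f := by
  rintro _ ⟨v, rfl⟩
  exact ⟨f v, by simp⟩

/-! ### Formal series in several variables

A formal series in `z₁^{±1}, …, z_k^{±1}` with coefficients in `M` is a function
`F : (Fin k → ℤ) → M`, where `F e` is the coefficient of `z₁^{e₁} ⋯ z_k^{e_k}`. A formal series in
one variable is a function `ℤ → M`, again indexed by the exponent; so if
`a(z) = ∑ₘ aₘ z^{-m-1}`, then `aₘ` is the value at `-m-1`. -/

section Series

variable {M : Type*} [AddCommGroup M]

/-- Membership in `M((z₁, …, z_k))`: the exponents of all the variables are bounded below. -/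
def IsLaurent {k : ℕ} (F : (Fin k → ℤ) → M) : Prop :=
  ∃ N : ℤ, ∀ e : Fin k → ℤ, (∃ i, e i < N) → F e = 0

/-- The product of a polynomial in `z₁, …, z_k` and a formal series. -/
def polyMul {k : ℕ} (p : MvPolynomial (Fin k) ℤ) (F : (Fin k → ℤ) → M) : (Fin k → ℤ) → M :=
  fun e => ∑ d ∈ p.support, p.coeff d • F (fun i => e i - (d i : ℤ))

/-- The coefficient of `z₀^j z^s` in `F(z₁, z)|_{z₁ = z + z₀}`, for `F ∈ M((z₁, z))`. Here
`(z + z₀)^p = ∑_{j ≥ 0} (p choose j) z^{p-j} z₀^j` for every integer `p`. The sum is finite as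
the exponents in `F` are bounded below. -/
def substCoeff (F : (Fin 2 → ℤ) → M) (j s : ℤ) : M :=
  if 0 ≤ j then ∑ᶠ p : ℤ, Ring.choose p j.toNat • F ![p, s + j - p] else 0

end Series

section Operators

variable {M : Type*} [AddCommGroup M] [Module HRing M]

/-- Membership of `A ∈ End(M)[[z₁^{±1}, …, z_k^{±1}]]` in
`ℰ^{(k)}(M) = Hom(M, M((z₁, …, z_k)))`. -/
def MemE {k : ℕ} (A : (Fin k → ℤ) → Module.End HRing M) : Prop :=
  ∀ w : M, IsLaurent fun e => A e w

/-- The product `a₁(z₁) ⋯ a_k(z_k)`. -/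
def opProd {k : ℕ} (a : Fin k → ℤ → Module.End HRing M) : (Fin k → ℤ) → Module.End HRing M :=
  fun e => (List.ofFn fun i => a i (e i)).prod

/-- The sequence `(a₁(z), …, a_k(z))` is compatible: for some positive integer `m`,
`(∏_{i < j} (z_i - z_j)^m) a₁(z₁) ⋯ a_k(z_k) ∈ ℰ^{(k)}(M)`. -/
def Compatible {k : ℕ} (a : Fin k → ℤ → Module.End HRing M) : Prop :=
  ∃ m : ℕ, 0 < m ∧
    MemE (polyMul (∏ i, ∏ j ∈ Finset.Ioi i, (MvPolynomial.X i - MvPolynomial.X j) ^ m) (opProd a))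

/-- `(z₁ - z)^k a(z₁) b(z)`. -/
def pairSeries (a b : ℤ → Module.End HRing M) (k : ℕ) : (Fin 2 → ℤ) → Module.End HRing M :=
  polyMul ((MvPolynomial.X 0 - MvPolynomial.X 1) ^ k) (opProd ![a, b])

end Operators

section HFields

variable {W : Type*} [AddCommGroup W] [Module HRing W]

/-- The map `π_n : End(W)[[z^{±1}]] → End(W / ħⁿW)[[z^{±1}]]`. -/
def red (n : ℕ) (a : ℤ → Module.End HRing W) : ℤ → Module.End HRing (W ⧸ hPow W n) :=
  fun m => (hPow W n).mapQ (hPow W n) (a m) (hPow_le_comap n (a m))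

variable (W) in
/-- `ℰ_ħ(W) = Hom(W, W₀((z))[[ħ]])` for `W = W₀[[ħ]]`, as a submodule of `End(W)[[z^{±1}]]`: a
series `∑ₘ wₘ z^m` over `W` lies in `W₀((z))[[ħ]]` if and only if for every `n` the
coefficients `wₘ` lie in `ħⁿW` for all `m` sufficiently negative. -/
def EH : Submodule HRing (ℤ → Module.End HRing W) where
  carrier := {a | ∀ (w : W) (n : ℕ), ∃ N : ℤ, ∀ m < N, a m w ∈ hPow W n}
  zero_mem' := fun _ _ => ⟨0, fun _ _ => Submodule.zero_mem _⟩
  add_mem' := by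
    intro a b ha hb w n
    obtain ⟨N₁, h₁⟩ := ha w n
    obtain ⟨N₂, h₂⟩ := hb w n
    exact ⟨min N₁ N₂, fun m hm => Submodule.add_mem _
      (h₁ m (lt_of_lt_of_le hm (min_le_left _ _))) (h₂ m (lt_of_lt_of_le hm (min_le_right _ _)))⟩
  smul_mem' := by
    intro c a ha w n
    obtain ⟨N, h⟩ := ha w n
    exact ⟨N, fun m hm => Submodule.smul_mem _ c (h m hm)⟩

/-- A set of series is `ħ`-adically compatible: for each finite sequence in it and each positive
integer `n`, the reductions modulo `ħⁿ` form a compatible sequence. -/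
def HCompatible (A : Set (ℤ → Module.End HRing W)) : Prop :=
  ∀ (k : ℕ) (a : Fin k → ℤ → Module.End HRing W), (∀ i, a i ∈ A) →
    ∀ n : ℕ, 0 < n → Compatible fun i => red n (a i)

/-- `Y_ℰ(a(z), z₀) b(z) = ∑ᵢ cᵢ(z) z₀^i`. That is, for each positive integer `n` the pair
`(π_n(a), π_n(b))` is compatible, and whenever
`(z₁ - z)^k π_n(a(z₁)) π_n(b(z)) ∈ ℰ^{(2)}(W / ħⁿW)`, the reduction modulo `ħⁿ` of
`∑ᵢ cᵢ(z) z₀^i` is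
`z₀^{-k} ((z₁ - z)^k π_n(a(z₁)) π_n(b(z)))|_{z₁ = z + z₀}`
(which does not depend on the choice of such a `k`). -/
def IsYE (a b : ℤ → Module.End HRing W) (c : ℤ → ℤ → Module.End HRing W) : Prop :=
  ∀ n : ℕ, 0 < n →
    (∃ k : ℕ, MemE (pairSeries (red n a) (red n b) k)) ∧
    ∀ k : ℕ, MemE (pairSeries (red n a) (red n b) k) →
      ∀ (i s : ℤ) (w : W ⧸ hPow W n),
        red n (c i) s w = substCoeff (fun e => pairSeries (red n a) (red n b) k e w) (i + k) s

end HFields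

/-- An `ħ`-adic nonlocal vertex algebra structure on the `ℂ[[ħ]]`-module `V`; `Y u m` is the
coefficient of `z^m` in `Y(u, z)`. -/
structure NonlocalVA (V : Type*) [AddCommGroup V] [Module HRing V] where
  topFree : TopologicallyFree V
  /-- The vacuum vector. -/
  vac : V
  /-- The vertex operator map. -/
  Y : V →ₗ[HRing] EH V
  /-- `Y(𝟙, z) v = v`. -/
  Y_vac : ∀ (m : ℤ) (v : V), (Y vac).1 m v = if m = 0 then v else 0
  /-- `Y(v, z) 𝟙 ∈ V[[z]]`. -/
  creation : ∀ (v : V) (m : ℤ), m < 0 → (Y v).1 m vac = 0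
  /-- `lim_{z → 0} Y(v, z) 𝟙 = v`. -/
  creation_zero : ∀ v : V, (Y v).1 0 vac = v
  compatible : HCompatible (Set.range fun u => (Y u).1)
  /-- `Y_ℰ(Y(u, z), z₀) Y(v, z) = Y(Y(u, z₀) v, z)`. -/
  assoc : ∀ u v : V, IsYE (Y u).1 (Y v).1 fun i => (Y ((Y u).1 i v)).1

/-- A module structure on the `ℂ[[ħ]]`-module `W` for the `ħ`-adic nonlocal vertex algebra `V`. -/
structure VAModule {V : Type*} [AddCommGroup V] [Module HRing V] (A : NonlocalVA V)
    (W : Type*) [AddCommGroup W] [Module HRing W] where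
  topFree : TopologicallyFree W
  /-- The vertex operator map `Y_W`. -/
  Y : V →ₗ[HRing] EH W
  /-- `Y_W(𝟙, z) = 1_W`. -/
  Y_vac : ∀ (m : ℤ) (w : W), (Y A.vac).1 m w = if m = 0 then w else 0
  compatible : HCompatible (Set.range fun u => (Y u).1)
  /-- `Y_ℰ(Y_W(u, z), z₀) Y_W(v, z) = Y_W(Y(u, z₀) v, z)`. -/
  assoc : ∀ u v : V, IsYE (Y u).1 (Y v).1 fun i => (Y ((A.Y u).1 i v)).1

/-- Homomorphisms of `ħ`-adic nonlocal vertex algebras. -/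
structure IsVAHom {U V : Type*} [AddCommGroup U] [Module HRing U] [AddCommGroup V]
    [Module HRing V] (A : NonlocalVA U) (B : NonlocalVA V) (f : U →ₗ[HRing] V) : Prop where
  map_vac : f A.vac = B.vac
  /-- `f(Y_U(u, z) v) = Y_V(f(u), z) f(v)`. -/
  map_Y : ∀ (u v : U) (m : ℤ), f ((A.Y u).1 m v) = (B.Y (f u)).1 m (f v)

section Generation

variable {V : Type*} [AddCommGroup V] [Module HRing V]

/-- The closure of a submodule in the `ħ`-adic topology. -/
def hClosure (P : Submodule HRing V) : Submodule HRing V := ⨅ n : ℕ, P ⊔ hPow V n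

/-- `[P] = {v ∈ V | ħⁿ v ∈ P for some positive integer n}`. -/
def bracket (P : Submodule HRing V) : Submodule HRing V where
  carrier := {v | ∃ n : ℕ, 0 < n ∧ hbar ^ n • v ∈ P}
  zero_mem' := ⟨1, one_pos, by simp⟩
  add_mem' := by
    rintro v w ⟨m, hm, hv⟩ ⟨n, -, hw⟩
    refine ⟨m + n, by omega, ?_⟩
    rw [smul_add]
    refine P.add_mem ?_ ?_
    · rw [pow_add, mul_comm, mul_smul]
      exact P.smul_mem _ hv
    · rw [pow_add, mul_smul]
      exact P.smul_mem _ hw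
  smul_mem' := by
    rintro c v ⟨n, hn, hv⟩
    exact ⟨n, hn, by rw [smul_comm]; exact P.smul_mem _ hv⟩

/-- `P' = span {uₘ v | u, v ∈ P, m ∈ ℤ}`. -/
def NonlocalVA.prime (A : NonlocalVA V) (P : Submodule HRing V) : Submodule HRing V :=
  Submodule.span HRing {x | ∃ u ∈ P, ∃ v ∈ P, ∃ m : ℤ, x = (A.Y u).1 m v}

/-- The submodules `S^{(n+1)}`, where `S^{(1)}` is the closure of `[span (S ∪ {𝟙})]`, and
`S^{(n+1)}` is the closure of `[(S^{(n)})']`. -/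
def NonlocalVA.gen (A : NonlocalVA V) (S : Set V) : ℕ → Submodule HRing V
  | 0 => hClosure (bracket (Submodule.span HRing (S ∪ {A.vac})))
  | n + 1 => hClosure (bracket (A.prime (A.gen S n)))

/-- `⟨S⟩`, the closure of `[⋃ₙ S^{(n)}]`. As the submodules `S^{(n)}` increase with `n`, their union
is their supremum. -/
def NonlocalVA.closure (A : NonlocalVA V) (S : Set V) : Submodule HRing V :=
  hClosure (bracket (⨆ n : ℕ, A.gen S n))

/-- `V` is generated by `S`. -/
def NonlocalVA.GeneratedBy (A : NonlocalVA V) (S : Set V) : Prop := A.closure S = ⊤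

end Generation

end

end HAdic

namespace HAdic

/-! ### Topologically free modules -/

section TopologicallyFree

variable {W : Type*} [AddCommGroup W] [Module HRing W]

/-! Take `ψ(u)` to be the constant term of `Y_V^U(u, z)𝟙`. Applied to `𝟙`, the two sides of
associativity for the `U`-module have no negative powers of `z`, so `z = 0` may be substituted; this
gives `ψ(Y_U(u, z₀)v) = Y_V^U(u, z₀)ψ(v)` (`IsYE.apply_zero`). It remains to see that `Y_V^U(u, z) =
Y_V(ψ(u), z)` for all `u`. This holds on `S` and at the vacuum. It passes to products `uₘv`, as both
sides are then coefficients of the same `Y_ℰ` (`IsYE.unique`), and to `[P]` and closures, as `V` is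
`ħ`-torsion-free and separated. Generation by `S` does the rest (`Y_eq_of_generatedBy`).

The delicate point is `IsLaurent.substCoeff_zero`: regularity in `z` is known only after `z₁ = z +
z₀` is expanded, and must be carried back to the series before substitution. -/

theorem TopologicallyFree.eq_zero_of_hbar_pow_smul (h : TopologicallyFree W) {n : ℕ} {w : W}
    (hw : hbar ^ n • w = 0) : w = 0 := by
  obtain ⟨W₀, _, _, e, he⟩ := h
  apply e.injective
  rw [map_zero]
  funext m
  have h1 := he (hbar ^ n) w (n + m)
  rw [hw, map_zero, Finset.sum_eq_single (n, m)] at h1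
  · simpa [hbar, PowerSeries.coeff_X_pow] using h1.symm
  · rintro ⟨a, b⟩ hab hne
    have : a ≠ n := by
      rintro rfl
      simp at hab hne
      exact hne hab
    simp [hbar, PowerSeries.coeff_X_pow, this]
  · simp

theorem TopologicallyFree.eq_zero_of_forall_mem_hPow (h : TopologicallyFree W) {w : W}
    (hw : ∀ n : ℕ, 0 < n → w ∈ hPow W n) : w = 0 := by
  obtain ⟨W₀, _, _, e, he⟩ := h
  apply e.injective
  rw [map_zero]
  funext m
  obtain ⟨v, rfl⟩ := hw (m + 1) m.succ_pos
  rw [LinearMap.lsmul_apply, he]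
  refine Finset.sum_eq_zero fun p hp => ?_
  have : p.1 ≠ m + 1 := by
    have := Finset.HasAntidiagonal.mem_antidiagonal.1 hp
    omega
  simp [hbar, PowerSeries.coeff_X_pow, this]

variable {U : Type*} [AddCommGroup U] [Module HRing U]

theorem bracket_le_ker (h : TopologicallyFree W) (f : U →ₗ[HRing] W) {P : Submodule HRing U}
    (hP : P ≤ LinearMap.ker f) : bracket P ≤ LinearMap.ker f := by
  rintro u ⟨n, -, hu⟩
  refine h.eq_zero_of_hbar_pow_smul (n := n) ?_
  rw [← map_smul]
  exact hP hu

/-- A linear map sends `ħⁿU` into `ħⁿW`, and the intersection of the `ħⁿW` is zero. -/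
theorem hClosure_le_ker (h : TopologicallyFree W) (f : U →ₗ[HRing] W) {P : Submodule HRing U}
    (hP : P ≤ LinearMap.ker f) : hClosure P ≤ LinearMap.ker f := by
  intro u hu
  refine h.eq_zero_of_forall_mem_hPow fun n _ => ?_
  obtain ⟨p, hp, _, ⟨x, rfl⟩, rfl⟩ := Submodule.mem_sup.1 ((Submodule.mem_iInf _).1 hu n)
  have hp0 : f p = 0 := hP hp
  exact ⟨f x, by simp [hp0]⟩

end TopologicallyFree

/-! ### Laurent expansions in `z + z₀` -/

section Binomial

/-- The coefficient of `t^j` in `(1 + t) d/dt (1 + t)^p = p (1 + t)^p`. -/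
theorem int_mul_choose (p : ℤ) (j : ℕ) :
    p * Ring.choose p j = j * Ring.choose p j + (j + 1) * Ring.choose p (j + 1) := by
  have h := Ring.choose_smul_choose p (n := j + 1) (k := j) (Nat.le_succ j)
  simp at h
  linear_combination -h

theorem int_choose_ne_zero {p : ℤ} {D : ℕ} (hp : p < 0 ∨ (D : ℤ) ≤ p) : Ring.choose p D ≠ 0 := by
  rcases hp with hp | hp
  · obtain ⟨n, rfl⟩ : ∃ n : ℕ, p = -((n : ℤ) + 1) := ⟨(-p - 1).toNat, by omega⟩
    rw [Ring.choose_neg]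
    have : ((n : ℤ) + 1 + D - 1) = ((n + D : ℕ) : ℤ) := by push_cast; ring
    rw [this, Ring.choose_natCast]
    have := Nat.choose_pos (Nat.le_add_left D n)
    simp [Units.smul_def]
    omega
  · obtain ⟨n, rfl⟩ := Int.eq_ofNat_of_zero_le ((Int.natCast_nonneg D).trans hp)
    rw [Ring.choose_natCast]
    have := Nat.choose_pos (Int.ofNat_le.1 hp)
    omega

variable {M : Type*} [AddCommGroup M]

theorem IsLaurent.eq_zero_of_notMem_Icc {F : (Fin 2 → ℤ) → M} {N : ℤ}
    (hN : ∀ e : Fin 2 → ℤ, (∃ i, e i < N) → F e = 0) {d p : ℤ}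
    (hp : p ∉ Finset.Icc N (d - N)) : F ![p, d - p] = 0 := by
  rw [Finset.mem_Icc, not_and_or] at hp
  rcases hp with hp | hp
  · exact hN _ ⟨0, by simpa using hp⟩
  · exact hN _ ⟨1, by simp at hp ⊢; omega⟩

theorem substCoeff_eq_sum {F : (Fin 2 → ℤ) → M} {N : ℤ}
    (hN : ∀ e : Fin 2 → ℤ, (∃ i, e i < N) → F e = 0) (j : ℕ) (d : ℤ) :
    substCoeff F j (d - j) =
      ∑ p ∈ Finset.Icc N (d - N), Ring.choose p j • F ![p, d - p] := by
  rw [substCoeff, if_pos (Int.natCast_nonneg j)]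
  simp only [sub_add_cancel, Int.toNat_natCast]
  refine finsum_eq_sum_of_support_subset _ fun p hp => ?_
  by_contra hmem
  exact hp (by simp only [IsLaurent.eq_zero_of_notMem_Icc hN (Finset.mem_coe.not.1 hmem), smul_zero])

variable [Module HRing M]

theorem eq_zero_of_zsmul_eq_zero {c : ℤ} (hc : c ≠ 0) {x : M} (hx : c • x = 0) : x = 0 := by
  have hc' : (c : ℂ) ≠ 0 := Int.cast_ne_zero.2 hc
  have h1 : (PowerSeries.C ((c : ℂ)⁻¹) : HRing) * (c : HRing) = 1 := by
    rw [← map_intCast (PowerSeries.C (R := ℂ)), ← map_mul, inv_mul_cancel₀ hc', map_one]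
  rw [← one_smul HRing x, ← h1, mul_smul, Int.cast_smul_eq_zsmul, hx, smul_zero]

/-- If `∑ₚ xₚ (1 + t)^p` is a polynomial in `t` of degree less than `D`, then `xₚ` vanishes unless
`0 ≤ p < D`. -/
theorem eq_zero_of_sum_choose_smul_eq_zero (D : ℕ) (s : Finset ℤ) (x : ℤ → M)
    (h : ∀ j : ℕ, D ≤ j → ∑ p ∈ s, Ring.choose p j • x p = 0) {p : ℤ} (hp : p ∈ s)
    (hpD : p < 0 ∨ (D : ℤ) ≤ p) : x p = 0 := by
  induction s using Finset.strongInduction generalizing x with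
  | H s ih =>
  by_cases hs : ∃ r ∈ s, r ≠ p
  · obtain ⟨r, hr, hrp⟩ := hs
    -- The operator `(1 + t) d/dt - r` kills `(1 + t)^r`, multiplies `x_q` by `q - r`, and does not
    -- raise the degree in `t`.
    have key : (p - r) • x p = 0 := by
      refine ih (s.erase r) (Finset.erase_ssubset hr) (fun q => (q - r) • x q) (fun j hj => ?_)
        (Finset.mem_erase.2 ⟨hrp.symm, hp⟩)
      have h0 : ∑ q ∈ s, Ring.choose q j • (q - r) • x q = 0 := by
        have e : ∀ q : ℤ, Ring.choose q j • (q - r) • x q =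
            ((j : ℤ) - r) • (Ring.choose q j • x q) +
              ((j : ℤ) + 1) • (Ring.choose q (j + 1) • x q) := by
          intro q
          simp only [← mul_smul, ← add_smul]
          congr 1
          linear_combination int_mul_choose q j
        simp only [e, Finset.sum_add_distrib, ← Finset.smul_sum, h j hj, h (j + 1) (by omega),
          smul_zero, add_zero]
      rw [← Finset.add_sum_erase s _ hr] at h0
      simpa using h0
    exact eq_zero_of_zsmul_eq_zero (sub_ne_zero.2 hrp.symm) key
  · push Not at hs
    have h0 := h D le_rfl
    rw [Finset.sum_eq_single_of_mem p hp fun q hq hqp => absurd (hs q hq) hqp] at h0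
    exact eq_zero_of_zsmul_eq_zero (int_choose_ne_zero hpD) h0

/-- If `F(z + z₀, z)` has no negative powers of `z`, then setting `z = 0` in it yields
`F(z₀, 0)`. -/
theorem IsLaurent.substCoeff_zero {F : (Fin 2 → ℤ) → M} (hF : IsLaurent F)
    (h : ∀ j s : ℤ, s < 0 → substCoeff F j s = 0) (d : ℤ) :
    substCoeff F d 0 = F ![d, 0] := by
  obtain ⟨N, hN⟩ := hF
  -- In total degree `d`, the coefficient of `z₀^j z^{d-j}` is `∑ₚ (p choose j) xₚ`, which vanishes
  -- for `j > d`. For `d < 0` the bound `(d + 1).toNat` is `0`, so the whole component vanishes.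
  have hx : ∀ p : ℤ, p < 0 ∨ ((d + 1).toNat : ℤ) ≤ p → F ![p, d - p] = 0 := by
    intro p hp
    by_cases hmem : p ∈ Finset.Icc N (d - N)
    · refine eq_zero_of_sum_choose_smul_eq_zero (d + 1).toNat _ (fun p => F ![p, d - p])
        (fun j hj => ?_) hmem hp
      rw [← substCoeff_eq_sum hN]
      exact h _ _ (by omega)
    · exact eq_zero_of_notMem_Icc hN hmem
  rcases lt_or_ge d 0 with hd | hd
  · have := hx d (Or.inl hd)
    rw [sub_self] at this
    rw [this, substCoeff, if_neg (by omega)]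
  · obtain ⟨n, rfl⟩ := Int.eq_ofNat_of_zero_le hd
    have e := substCoeff_eq_sum hN n n
    rw [sub_self] at e
    rw [e, Finset.sum_eq_single (n : ℤ)]
    · simp [Ring.choose_natCast]
    · intro p _ hpn
      rcases lt_or_ge p 0 with hp | hp
      · rw [hx p (Or.inl hp), smul_zero]
      · obtain ⟨q, rfl⟩ := Int.eq_ofNat_of_zero_le hp
        rcases lt_or_ge q n with hq | hq
        · rw [Ring.choose_natCast, Nat.choose_eq_zero_of_lt hq, Nat.cast_zero, zero_smul]
        · rw [hx q (Or.inr (by omega)), smul_zero]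
    · intro hmem
      rw [eq_zero_of_notMem_Icc hN hmem, smul_zero]

end Binomial

/-! ### The product `(z₁ - z)^k a(z₁) b(z)` at `z = 0` -/

theorem coeff_X_sub_X_pow (k n : ℕ) :
    MvPolynomial.coeff (Finsupp.single (0 : Fin 2) n)
      ((MvPolynomial.X 0 - MvPolynomial.X 1 : MvPolynomial (Fin 2) ℤ) ^ k) =
      if n = k then 1 else 0 := by
  induction k generalizing n with
  | zero =>
    rw [pow_zero, MvPolynomial.coeff_one]
    simp [eq_comm]
  | succ k ih =>
    rw [pow_succ, mul_sub, MvPolynomial.coeff_sub, MvPolynomial.coeff_mul_X',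
      MvPolynomial.coeff_mul_X']
    have h1 : (1 : Fin 2) ∉ (Finsupp.single (0 : Fin 2) n).support := by simp
    rw [if_neg h1, sub_zero]
    rcases n with _ | n
    · simp
    · rw [if_pos (by simp), ← Finsupp.single_tsub, Nat.add_sub_cancel, ih]
      simp

/-- As `b(z)w` has no negative powers, `z = 0` may be set in each factor, and `(z₁ - z)^k` becomes
`z₁^k`. -/
theorem pairSeries_apply_zero {M : Type*} [AddCommGroup M] [Module HRing M]
    (a b : ℤ → Module.End HRing M) (k : ℕ) {w : M} (hb : ∀ m < 0, b m w = 0) (i : ℤ) :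
    pairSeries a b k ![i + k, 0] w = a i (b 0 w) := by
  have hF : ∀ d : Fin 2 →₀ ℕ,
      opProd ![a, b] (fun l => (![i + k, 0] : Fin 2 → ℤ) l - (d l : ℤ)) w =
        a (i + k - d 0) (b (-(d 1 : ℤ)) w) := by
    intro d
    simp [opProd, List.ofFn_succ]
  rw [pairSeries, polyMul, LinearMap.sum_apply,
    Finset.sum_eq_single (Finsupp.single (0 : Fin 2) k)]
  · rw [LinearMap.smul_apply, hF, coeff_X_sub_X_pow]
    simp
  · intro d _ hd
    rw [LinearMap.smul_apply, hF]
    rcases Nat.eq_zero_or_pos (d 1) with h1 | h1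
    · have hd0 : d = Finsupp.single 0 (d 0) := by
        ext l
        fin_cases l <;> simp [h1]
      rw [hd0, coeff_X_sub_X_pow, if_neg, zero_smul]
      intro h
      exact hd (h ▸ hd0)
    · rw [hb _ (by omega), map_zero, smul_zero]
  · intro hd
    rw [MvPolynomial.notMem_support_iff.1 hd, zero_smul, LinearMap.zero_apply]

/-! ### The product `Y_ℰ(a(z), z₀) b(z)` -/

section IsYE

variable {W : Type*} [AddCommGroup W] [Module HRing W]

@[simp]
theorem red_apply_mk (n : ℕ) (a : ℤ → Module.End HRing W) (m : ℤ) (w : W) :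
    red n a m ((hPow W n).mkQ w) = (hPow W n).mkQ (a m w) := rfl

theorem eq_of_forall_mkQ_eq (hW : TopologicallyFree W) {v w : W}
    (h : ∀ n : ℕ, 0 < n → (hPow W n).mkQ v = (hPow W n).mkQ w) : v = w :=
  sub_eq_zero.1 <| hW.eq_zero_of_forall_mem_hPow fun n hn =>
    (Submodule.Quotient.eq _).1 (h n hn)

/-- Modulo each `ħⁿ`, one admissible `k` computes both series. -/
theorem IsYE.unique (hW : TopologicallyFree W) {a b : ℤ → Module.End HRing W}
    {c c' : ℤ → ℤ → Module.End HRing W} (h : IsYE a b c) (h' : IsYE a b c') : c = c' := by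
  funext i s
  ext w
  refine eq_of_forall_mkQ_eq hW fun n hn => ?_
  obtain ⟨⟨k, hk⟩, h1⟩ := h n hn
  rw [← red_apply_mk, ← red_apply_mk, h1 k hk, (h' n hn).2 k hk]

theorem IsYE.apply_zero (hW : TopologicallyFree W) {a b : ℤ → Module.End HRing W}
    {c : ℤ → ℤ → Module.End HRing W} (h : IsYE a b c) {w : W} (hb : ∀ m < 0, b m w = 0)
    (hc : ∀ i, ∀ m < 0, c i m w = 0) (i : ℤ) : c i 0 w = a i (b 0 w) := by
  refine eq_of_forall_mkQ_eq hW fun n hn => ?_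
  obtain ⟨⟨k, hk⟩, h1⟩ := h n hn
  rw [← red_apply_mk, h1 k hk, IsLaurent.substCoeff_zero (hk _), pairSeries_apply_zero]
  · rfl
  · intro m hm
    rw [red_apply_mk, hb m hm, map_zero]
  · intro j s hs
    -- The shift by `k` undoes the factor `z₀^{-k}`.
    have := h1 k hk (j - k) s ((hPow W n).mkQ w)
    rw [sub_add_cancel, red_apply_mk, hc _ s hs, map_zero] at this
    exact this.symm

end IsYE

/-! ### Vertex algebra homomorphisms from modules -/

section Module

variable {U V : Type*} [AddCommGroup U] [Module HRing U] [AddCommGroup V] [Module HRing V]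

/-- The vertex operators `u ↦ Y(u, z)`, with the coefficient of `z^m` applied to `w`. -/
noncomputable def coeffApply (Y : U →ₗ[HRing] EH V) (m : ℤ) (w : V) : U →ₗ[HRing] V :=
  (LinearMap.applyₗ w).comp ((LinearMap.proj m).comp ((EH V).subtype.comp Y))

@[simp]
theorem coeffApply_apply (Y : U →ₗ[HRing] EH V) (m : ℤ) (w : V) (u : U) :
    coeffApply Y m w u = (Y u).1 m w := rfl

theorem NonlocalVA.Y_eq_of_generatedBy (A : NonlocalVA U) {S : Set U} (hS : A.GeneratedBy S)
    (hV : TopologicallyFree V) (Y Y' : U →ₗ[HRing] EH V) (hvac : Y A.vac = Y' A.vac)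
    (hYS : ∀ s ∈ S, Y s = Y' s)
    (hprod : ∀ u v, Y u = Y' u → Y v = Y' v → ∀ m, Y ((A.Y u).1 m v) = Y' ((A.Y u).1 m v))
    (u : U) : Y u = Y' u := by
  -- The equality is tested on each coefficient and vector, so that the kernel lemmas apply to maps
  -- into `V` rather than into `EH V`.
  have hmem : ∀ {P : Submodule HRing U}, (∀ v ∈ P, Y v = Y' v) ↔
      ∀ m w, P ≤ LinearMap.ker (coeffApply (Y - Y') m w) := by
    intro P
    constructor
    · intro h m w v hv
      rw [LinearMap.mem_ker, coeffApply_apply, LinearMap.sub_apply, h v hv, sub_self]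
      rfl
    · intro h v hv
      refine Subtype.ext (funext fun m => LinearMap.ext fun w => sub_eq_zero.1 ?_)
      exact h m w hv
  have hclos : ∀ {P : Submodule HRing U}, (∀ v ∈ P, Y v = Y' v) →
      ∀ v ∈ hClosure (bracket P), Y v = Y' v := fun hP =>
    hmem.2 fun m w => hClosure_le_ker hV _ (bracket_le_ker hV _ (hmem.1 hP m w))
  have hspan : ∀ {T : Set U}, (∀ v ∈ T, Y v = Y' v) →
      ∀ v ∈ Submodule.span HRing T, Y v = Y' v := fun {T} hT v hv =>
    (Submodule.span_le (p := LinearMap.eqLocus Y Y')).2 hT hv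
  have hgen : ∀ n, ∀ v ∈ A.gen S n, Y v = Y' v := by
    intro n
    induction n with
    | zero =>
      refine hclos (hspan ?_)
      rintro v (hv | rfl)
      exacts [hYS v hv, hvac]
    | succ n ih =>
      refine hclos (hspan ?_)
      rintro _ ⟨v, hv, v', hv', m, rfl⟩
      exact hprod v v' (ih v hv) (ih v' hv') m
  refine hclos (P := ⨆ n, A.gen S n) (fun v hv => ?_) u (?_ : u ∈ A.closure S)
  · exact (iSup_le hgen : ⨆ n, A.gen S n ≤ LinearMap.eqLocus Y Y') hv
  · rw [show A.closure S = ⊤ from hS]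
    trivial

end Module

end HAdic

theorem mainTheorem8 {U V : Type*} [AddCommGroup U] [Module HAdic.HRing U]
    [AddCommGroup V] [Module HAdic.HRing V]
    (A : HAdic.NonlocalVA U) (B : HAdic.NonlocalVA V)
    (S : Submodule HAdic.HRing U) (hS : A.GeneratedBy (S : Set U))
    (YUV : HAdic.VAModule A V)
    (hvac : ∀ (u : U) (m : ℤ), m < 0 → (YUV.Y u).1 m B.vac = 0)
    (ψ₀ : S →ₗ[HAdic.HRing] V)
    (hψ₀ : ∀ s : S, YUV.Y (s : U) = B.Y (ψ₀ s)) :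
    ∃ ψ : U →ₗ[HAdic.HRing] V, HAdic.IsVAHom A B ψ ∧ ∀ s : S, ψ (s : U) = ψ₀ s := by
  let ψ : U →ₗ[HAdic.HRing] V := HAdic.coeffApply YUV.Y 0 B.vac
  have hψvac : ψ A.vac = B.vac := (YUV.Y_vac 0 B.vac).trans (if_pos rfl)
  have hψS : ∀ s : S, ψ (s : U) = ψ₀ s := by
    intro s
    rw [HAdic.coeffApply_apply, hψ₀, B.creation_zero]
  have hψY : ∀ (u v : U) (m : ℤ), ψ ((A.Y u).1 m v) = (YUV.Y u).1 m (ψ v) := fun u v m =>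
    (YUV.assoc u v).apply_zero B.topFree (hvac v) (fun i => hvac _) m
  have hY : ∀ u, YUV.Y u = (B.Y ∘ₗ ψ) u := by
    refine A.Y_eq_of_generatedBy hS B.topFree _ _ ?_ ?_ ?_
    · refine Subtype.ext (funext fun m => LinearMap.ext fun w => ?_)
      rw [LinearMap.comp_apply, hψvac, YUV.Y_vac, B.Y_vac]
    · intro s hs
      rw [LinearMap.comp_apply, hψS ⟨s, hs⟩, ← hψ₀]
    · intro u v hu hv m
      have h := YUV.assoc u v
      -- Now `h` and associativity in `V` describe `Y_ℰ` of the same pair.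
      rw [hu, hv] at h
      refine Subtype.ext ?_
      rw [LinearMap.comp_apply, hψY, hu]
      exact congrFun (h.unique B.topFree (B.assoc (ψ u) (ψ v))) m
  refine ⟨ψ, ⟨hψvac, fun u v m => ?_⟩, hψS⟩
  rw [hψY, hY, LinearMap.comp_apply]
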